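/- Consider the sixth-order member of the second Painlev\'e hierarchy $$w^{(6)}-14w^2w^{(4)}-56\,w\,w'w'''-42\,w\,(w'')^2-70\,(w')^2w''+70\,w^4w''+140\,w^3(w')^2-20\,w^7-z\,w-\alpha=0 .\qquad(*)$$ (1) There is exactly one sequence of polynomials $Q_n=Q_n^{[3]}\in\mathbb C[z]$, $n\ge 0$, such that $Q_0=1$, every $Q_n$ is monic, and for each $n\ge1$ the rational function $w(z;n)=\frac{d}{dz}\ln\frac{Q_{n-1}(z)}{Q_n(z)}=\frac{Q_{n-1}'}{Q_{n-1}}-\frac{Q_n'}{Q_n}$ solves $(*)$ with $\alpha=n$. (2) For each $\alpha\in\mathbb C$ there is exactly one formal series at infinity $w(z;\alpha)=\sum_{m\ge0}c_{\alpha,-(m+1)}z^{-m-1}$ that solves $(*)$, and $c_{\alpha,-(m+1)}=0$ unless $7\mid m$. (3) For every $n\ge0$ the polynomial $Q_n^{[3]}$ has degree $N=n(n+1)/2=-\sum_{i=1}^n c_{i,-1}$; and if $$Q_n^{[3]}(z)=\sum_{m=0}^{N}A_{n,m}z^{N-m},$$ then all the coefficients $A_{n,m}$ are obtained from the first $N+1$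 coefficients $c_{i,-1},c_{i,-2},\dots,c_{i,-(N+1)}$ of the expansions in (2) at $\alpha=i$, $1\le i\le n$, by $A_{n,0}=1$ and $$A_{n,m}=\frac1m\sum_{j=1}^{m}\Bigl(\sum_{i=2}^{n}c_{i,-(j+1)}\Bigr)A_{n,m-j},\qquad 1\le m\le N .$$ Moreover $A_{n,m}=0$ for all $0\le m\le N$ with $7\nmid m$. -/

import Mathlib

open Polynomial

/-- Left-hand side of the sixth-order (third) member of the second Painlevé hierarchy,
`w⁽⁶⁾ - 14 w² w⁗ - 56 w w' w''' - 42 w (w'')² - 70 (w')² w'' + 70 w⁴ w'' + 140 w³ (w')²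
  - 20 w⁷ - z w - α`,
in a commutative ring `R` with differentiation `D`, independent variable `z` and parameter `α`. -/
def sixthOrderP2 {R : Type*} [CommRing R] (D : R → R) (z α w : R) : R :=
  D^[6] w - 14 * w ^ 2 * D^[4] w - 56 * w * D w * D^[3] w - 42 * w * (D^[2] w) ^ 2
    - 70 * (D w) ^ 2 * D^[2] w + 70 * w ^ 4 * D^[2] w + 140 * w ^ 3 * (D w) ^ 2
    - 20 * w ^ 7 - z * w - α

/-- Differentiation `d/dz` of rational functions in `z`, by the quotient rule. -/
noncomputable def ratDeriv (f : RatFunc ℂ) : RatFunc ℂ :=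
  algebraMap ℂ[X] (RatFunc ℂ)
      (derivative f.num * f.denom - f.num * derivative f.denom) /
    algebraMap ℂ[X] (RatFunc ℂ) (f.denom ^ 2)

/-- The logarithmic derivative `p' / p` of a polynomial, as a rational function. -/
noncomputable def ratLogDeriv (p : ℂ[X]) : RatFunc ℂ :=
  algebraMap ℂ[X] (RatFunc ℂ) (derivative p) / algebraMap ℂ[X] (RatFunc ℂ) p

/-- `Q` is the sequence of special polynomials `Q_n^{[3]}` attached to the sixth-order equation:
`Q_0 = 1`, all `Q_n` are monic, and for every `n ≥ 1` the rational function
`w(z; n) = d/dz ln (Q_{n-1} / Q_n) = Q_{n-1}' / Q_{n-1} - Q_n' / Q_n`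
solves the equation with parameter `α = n`. -/
structure IsSpecialPolynomials (Q : ℕ → ℂ[X]) : Prop where
  zero : Q 0 = 1
  monic : ∀ n, (Q n).Monic
  solves : ∀ n : ℕ, 1 ≤ n →
    sixthOrderP2 ratDeriv RatFunc.X (n : RatFunc ℂ)
      (ratLogDeriv (Q (n - 1)) - ratLogDeriv (Q n)) = 0

/-- Differentiation `d/dz` of a formal Laurent series in the local parameter `t = 1 / z`
at `z = ∞`, that is, `- t² d/dt`. -/
noncomputable def derivAtInfty (f : LaurentSeries ℂ) : LaurentSeries ℂ :=
  -(HahnSeries.single (2 : ℤ) (1 : ℂ) * LaurentSeries.derivative ℂ f)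

/-- The formal series `∑_{m ≥ 0} c m * z ^ (-m - 1)` at `z = ∞`, as a series in `t = 1 / z`. -/
noncomputable def seriesAtInfty (c : ℕ → ℂ) : LaurentSeries ℂ :=
  HahnSeries.ofPowerSeries ℤ ℂ (PowerSeries.X * PowerSeries.mk c)

/-- `∑_{m ≥ 0} c m * z ^ (-m - 1)` is a power expansion at infinity of solutions of the
sixth-order equation with parameter `α`; here `z = t⁻¹`. -/
def IsExpansionAtInfty (α : ℂ) (c : ℕ → ℂ) : Prop :=
  sixthOrderP2 derivAtInfty (HahnSeries.single (-1 : ℤ) (1 : ℂ)) (HahnSeries.C α)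
    (seriesAtInfty c) = 0

/-- The coefficient `A_{n,m}` of `z ^ (n (n + 1) / 2 - m)` in `Q_n`, for `m ≤ n (n + 1) / 2`. -/
noncomputable def coeffA (Q : ℕ → ℂ[X]) (n m : ℕ) : ℂ :=
  (Q n).coeff (n * (n + 1) / 2 - m)

/-! Existence. With `u = w' - w²` and `L` the third Lenard polynomial, the equation reads `L(u)' + 2
w L(u) - z w - α = 0`. The sign change `w ↦ -w` carries `α = n` to `-n`. A shift of `-w` by
`(2n+1)/G`, with `G = 2 L(-w' - w²) - z`, keeps the Miura transform and raises the parameter to `n +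
1` (`exists_backlund`). In terms of tau functions, `w = (ln (S/T))'` with `u = 2 (ln S)''` is
replaced by `(ln (T/R))'` with `R = G T²/S`. The Miura relation is a bilinear equation for
consecutive tau functions; its indicial equation at any finite point forces a nonnegative order, so
they have no poles and are polynomials (`exists_polynomial_of_bilinear`).

Uniqueness and coefficients. For `f = z w` and `t = 1/z` the equation becomes `f = t⁷ W(f) - α`, an
adic contraction that preserves series in `t⁷`. So the expansion exists, is unique, and has
exponents only in multiples of seven. Telescoping gives `Q_n'/Q_n = -∑ w(z; i)`, so the expansions
determine the logarithmic derivative of `Q_n`, hence its degree and, through a Newton-type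
recursion, all its coefficients. -/

/-- The third Lenard differential polynomial `u⁗ + 10 u u'' + 5 (u')² + 10 u³` of the KdV
hierarchy. -/
def lenardThree {R : Type*} [CommRing R] (D : R → R) (u : R) : R :=
  D^[4] u + 10 * u * D^[2] u + 5 * (D u) ^ 2 + 10 * u ^ 3

/-- The sixth-order equation factors through the Miura map `w ↦ w' - w²`. -/
theorem sixthOrderP2_eq_lenardThree {R : Type*} [CommRing R] [Algebra ℂ R] (D : Derivation ℂ R R)
    (z α w : R) :
    sixthOrderP2 D z α w =
      D (lenardThree D (D w - w ^ 2)) + 2 * w * lenardThree D (D w - w ^ 2) - z * w - α := by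
  obtain ⟨w1, h1⟩ : ∃ x, D w = x := ⟨_, rfl⟩
  obtain ⟨w2, h2⟩ : ∃ x, D w1 = x := ⟨_, rfl⟩
  obtain ⟨w3, h3⟩ : ∃ x, D w2 = x := ⟨_, rfl⟩
  obtain ⟨w4, h4⟩ : ∃ x, D w3 = x := ⟨_, rfl⟩
  obtain ⟨w5, h5⟩ : ∃ x, D w4 = x := ⟨_, rfl⟩
  obtain ⟨w6, h6⟩ : ∃ x, D w5 = x := ⟨_, rfl⟩
  have n (k : ℕ) [k.AtLeastTwo] : D (OfNat.ofNat k : R) = 0 := D.map_natCast k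
  have u1 : D (w1 - w ^ 2) = w2 - 2 * w * w1 := by
    simp only [map_sub, Derivation.leibniz_pow, smul_eq_mul, nsmul_eq_mul, h1, h2]; push_cast; ring
  have u2 : D (w2 - 2 * w * w1) = w3 - 2 * w * w2 - 2 * w1 ^ 2 := by
    simp only [map_sub, Derivation.leibniz, smul_eq_mul, h1, h2, h3, n]; ring
  have u3 : D (w3 - 2 * w * w2 - 2 * w1 ^ 2) = w4 - 2 * w * w3 - 6 * w1 * w2 := by
    simp only [map_sub, Derivation.leibniz, pow_two, smul_eq_mul, h1, h2, h3, h4, n]; ring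
  have u4 : D (w4 - 2 * w * w3 - 6 * w1 * w2) = w5 - 2 * w * w4 - 8 * w1 * w3 - 6 * w2 ^ 2 := by
    simp only [map_sub, Derivation.leibniz, smul_eq_mul, h1, h2, h3, h4, h5, n]; ring
  have u5 : D (w5 - 2 * w * w4 - 8 * w1 * w3 - 6 * w2 ^ 2) =
      w6 - 2 * w * w5 - 10 * w1 * w4 - 20 * w2 * w3 := by
    simp only [map_sub, Derivation.leibniz, pow_two, smul_eq_mul, h1, h2, h3, h4, h5, h6, n]; ring
  simp only [sixthOrderP2, lenardThree, Function.iterate_succ, Function.iterate_zero,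
    Function.comp_apply, id_eq, h1, h2, h3, h4, h5, h6, u1, u2, u3, u4]
  generalize hu : w1 - w ^ 2 = u at u1
  generalize hv1 : w2 - 2 * w * w1 = v1 at u1 u2
  generalize hv2 : w3 - 2 * w * w2 - 2 * w1 ^ 2 = v2 at u2 u3
  simp only [map_add, Derivation.leibniz, Derivation.leibniz_pow, smul_eq_mul, nsmul_eq_mul, n,
    u1, u2, u3, u5]
  subst hu hv1 hv2
  push_cast
  ring

theorem sixthOrderP2_neg {R : Type*} [CommRing R] [Algebra ℂ R] (D : Derivation ℂ R R)
    (z α w : R) : sixthOrderP2 D z (-α) (-w) = -sixthOrderP2 D z α w := by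
  simp only [sixthOrderP2, Function.iterate_succ, Function.iterate_zero,
    Function.comp_apply, id_eq, map_neg]
  ring

/-! ### Bäcklund transformation and tau functions -/

section Backlund

variable {K : Type*} [Field K] [Algebra ℂ K] (D : Derivation ℂ K K)

/-- If `w = (ln (S / T))'` satisfies `w' - w² = 2 (ln S)''`, then `S` and `T` satisfy the bilinear
equation `S'' T - 2 S' T' + S T'' = 0`. -/
theorem bilinear_of_miura {S T : K} (hS : S ≠ 0) (hT : T ≠ 0)
    (h : D (D S / S - D T / T) - (D S / S - D T / T) ^ 2 = 2 * D (D S / S)) :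
    D (D S) * T - 2 * D S * D T + S * D (D T) = 0 := by
  rw [map_sub, Derivation.leibniz_div, Derivation.leibniz_div] at h
  simp only [smul_eq_mul] at h
  field_simp at h
  have : S * T * (D (D S) * T - 2 * D S * D T + S * D (D T)) = 0 := by linear_combination -h
  simpa [hS, hT] using this

/-- The Bäcklund transformation of the sixth-order equation in terms of tau functions. -/
theorem exists_backlund {z S T : K} (hz : D z = 1) (hS : S ≠ 0) (hT : T ≠ 0) (n : ℕ)
    (hP : sixthOrderP2 D z n (D S / S - D T / T) = 0)
    (h : D (D S / S - D T / T) - (D S / S - D T / T) ^ 2 = 2 * D (D S / S)) :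
    ∃ R : K, R ≠ 0 ∧ sixthOrderP2 D z (n + 1 : ℕ) (D T / T - D R / R) = 0 ∧
      D (D T / T - D R / R) - (D T / T - D R / R) ^ 2 = 2 * D (D T / T) := by
  have : CharZero K := charZero_of_injective_algebraMap (algebraMap ℂ K).injective
  have hlog (a b : K) (ha : a ≠ 0) (hb : b ≠ 0) : D (a * b) / (a * b) = D a / a + D b / b := by
    simp only [Derivation.leibniz, smul_eq_mul]; field_simp; ring
  obtain ⟨w, hw⟩ : ∃ w, D S / S - D T / T = w := ⟨_, rfl⟩
  have hN := sixthOrderP2_neg D z n w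
  rw [hw] at hP h
  rw [hP, sixthOrderP2_eq_lenardThree, map_neg, neg_sq] at hN
  -- Changing the sign of `w` moves the Miura transform from `2 (ln S)''` to `2 (ln T)''`.
  have hu : -D w - w ^ 2 = 2 * D (D T / T) := by
    have : D w = D (D S / S) - D (D T / T) := by rw [← hw, map_sub]
    linear_combination h - 2 * this
  obtain ⟨G, hG⟩ : ∃ G, 2 * lenardThree D (-D w - w ^ 2) - z = G := ⟨_, rfl⟩
  -- This is twice the equation for `-w` with parameter `-n`, rewritten in `G`; the extra `-1` is
  -- `-D z`.
  have hDG : D G - 2 * w * G = -(2 * n + 1) := by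
    have n2 : D (2 : K) = 0 := D.map_natCast 2
    rw [← hG, map_sub, hz, Derivation.leibniz, n2]
    simp only [smul_eq_mul]
    linear_combination 2 * hN
  have hn : (2 * n + 1 : K) ≠ 0 := by exact_mod_cast (2 * n).succ_ne_zero
  have hG0 : G ≠ 0 := by
    rintro rfl
    simp only [map_zero, mul_zero, sub_zero] at hDG
    exact hn (by linear_combination hDG)
  -- The choice `R = G T²/S` is made so that its logarithmic derivative turns `G'/G = 2w - (2n+1)/G`
  -- into the shift of `-w`.
  have hw' : D T / T - D (G * (T * T) / S) / (G * (T * T) / S) = -w + (2 * n + 1) / G := by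
    have h1 : D (G * (T * T) / S) / (G * (T * T) / S) = D G / G + 2 * (D T / T) - D S / S := by
      have h2 : G * (T * T) / S ≠ 0 := by simp [hG0, hT, hS]
      have h3 := hlog (G * (T * T) / S) S h2 hS
      rw [div_mul_cancel₀ _ hS, hlog G _ hG0 (mul_ne_zero hT hT), hlog T T hT hT] at h3
      linear_combination -h3
    have h4 : D G / G = 2 * w - (2 * n + 1) / G := by
      field_simp; linear_combination hDG
    rw [h1, h4]; linear_combination hw
  have hM : D (-w + (2 * n + 1) / G) - (-w + (2 * n + 1) / G) ^ 2 = -D w - w ^ 2 := by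
    have hc : D (2 * n + 1 : K) = 0 := by exact_mod_cast D.map_natCast (2 * n + 1)
    rw [map_add, map_neg, Derivation.leibniz_div, hc]
    simp only [smul_eq_mul]
    field_simp
    linear_combination -(2 * n + 1 : K) * hDG
  refine ⟨G * (T * T) / S, by simp [hG0, hT, hS], ?_, ?_⟩
  · rw [hw', sixthOrderP2_eq_lenardThree, hM]
    have hc : (2 * n + 1) / G * (2 * lenardThree D (-D w - w ^ 2) - z) = 2 * n + 1 := by
      rw [hG]; field_simp
    push_cast
    linear_combination hN + hc
  · rw [hw', hM, hu]

end Backlund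

/-! ### Derivations on Laurent series -/

section LaurentDerivation

open HahnSeries

/-- The coefficientwise algebra structure, which matches the module structure of Laurent series. -/
noncomputable instance laurentSeriesAlgebra : Algebra ℂ (LaurentSeries ℂ) :=
  HahnSeries.instAlgebra

theorem laurent_derivative_single_mul (n : ℤ) (p : PowerSeries ℂ) :
    LaurentSeries.derivative ℂ (single n (1 : ℂ) * ofPowerSeries ℤ ℂ p) =
      single (n - 1) (1 : ℂ) * ofPowerSeries ℤ ℂ
        (PowerSeries.C (n : ℂ) * p + PowerSeries.X * PowerSeries.derivative ℂ p) := by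
  ext k
  obtain ⟨j, rfl⟩ : ∃ j, k = j + (n - 1) := ⟨k - (n - 1), by ring⟩
  rw [LaurentSeries.derivative_apply, LaurentSeries.hasseDeriv_coeff, coeff_single_mul_add,
    show j + (n - 1) + ((1 : ℕ) : ℤ) = j + n by push_cast; ring, coeff_single_mul_add,
    Ring.choose_one_right, one_mul, one_mul]
  rcases lt_or_ge j 0 with hj | hj
  · rw [PowerSeries.coeff_coe, PowerSeries.coeff_coe, if_pos hj, if_pos hj, smul_zero]
  · lift j to ℕ using hj
    rw [LaurentSeries.coeff_coe_powerSeries, LaurentSeries.coeff_coe_powerSeries, map_add,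
      PowerSeries.coeff_C_mul]
    cases j with
    | zero => simp
    | succ j =>
      rw [PowerSeries.coeff_succ_X_mul, PowerSeries.coeff_derivative]
      simp
      ring

theorem exists_eq_single_mul (x : LaurentSeries ℂ) (hx : x ≠ 0) :
    ∃ (n : ℤ) (p : PowerSeries ℂ), PowerSeries.constantCoeff p ≠ 0 ∧
      x = single n (1 : ℂ) * ofPowerSeries ℤ ℂ p := by
  refine ⟨x.order, LaurentSeries.powerSeriesPart x, ?_,
    (LaurentSeries.single_order_mul_powerSeriesPart x).symm⟩
  rw [← PowerSeries.coeff_zero_eq_constantCoeff_apply, LaurentSeries.powerSeriesPart_coeff]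
  simpa using HahnSeries.coeff_order_eq_zero.not.mpr hx

/-- Nonzero series have the form `tⁿ p` with `p` a power series, which reduces the claim to the
product rule for power series. -/
theorem laurent_derivative_leibniz (x y : LaurentSeries ℂ) :
    LaurentSeries.derivative ℂ (x * y) =
      x * LaurentSeries.derivative ℂ y + y * LaurentSeries.derivative ℂ x := by
  rcases eq_or_ne x 0 with rfl | hx
  · simp
  rcases eq_or_ne y 0 with rfl | hy
  · simp
  obtain ⟨n, p, -, rfl⟩ := exists_eq_single_mul x hx
  obtain ⟨m, q, -, rfl⟩ := exists_eq_single_mul y hy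
  have h1 : (single n (1 : ℂ) * ofPowerSeries ℤ ℂ p) * (single m (1 : ℂ) * ofPowerSeries ℤ ℂ q) =
      single (n + m) (1 : ℂ) * ofPowerSeries ℤ ℂ (p * q) := by
    rw [map_mul, show single (n + m) (1 : ℂ) = single n 1 * single m 1 by simp]; ring
  have h2 : single (n + m - 1) (1 : ℂ) = single n 1 * single (m - 1) 1 := by
    rw [single_mul_single]; simp [add_sub_assoc]
  have h3 : single (n + m - 1) (1 : ℂ) = single m 1 * single (n - 1) 1 := by
    rw [single_mul_single, mul_one, add_comm n m, add_sub_assoc]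
  rw [h1, laurent_derivative_single_mul, laurent_derivative_single_mul,
    laurent_derivative_single_mul]
  have h4 : single n (1 : ℂ) * ofPowerSeries ℤ ℂ p * (single (m - 1) 1 * ofPowerSeries ℤ ℂ
        (PowerSeries.C (m : ℂ) * q + PowerSeries.X * PowerSeries.derivative ℂ q)) =
      single (n + m - 1) (1 : ℂ) * ofPowerSeries ℤ ℂ
        (p * (PowerSeries.C (m : ℂ) * q + PowerSeries.X * PowerSeries.derivative ℂ q)) := by
    rw [h2, map_mul]; ring
  have h5 : single m (1 : ℂ) * ofPowerSeries ℤ ℂ q * (single (n - 1) 1 * ofPowerSeries ℤ ℂ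
        (PowerSeries.C (n : ℂ) * p + PowerSeries.X * PowerSeries.derivative ℂ p)) =
      single (n + m - 1) (1 : ℂ) * ofPowerSeries ℤ ℂ
        (q * (PowerSeries.C (n : ℂ) * p + PowerSeries.X * PowerSeries.derivative ℂ p)) := by
    rw [h3, map_mul]; ring
  rw [h4, h5, ← mul_add, ← map_add]
  congr 2
  rw [Derivation.leibniz]
  push_cast
  rw [map_add]
  simp only [smul_eq_mul]
  ring

/-- Differentiation of Laurent series as a derivation. -/
noncomputable def laurentDerivation : Derivation ℂ (LaurentSeries ℂ) (LaurentSeries ℂ) :=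
  Derivation.mk' (LaurentSeries.derivative ℂ) laurent_derivative_leibniz

/-- Differentiation `d/dz` at infinity as a derivation. -/
noncomputable def inftyDerivation : Derivation ℂ (LaurentSeries ℂ) (LaurentSeries ℂ) :=
  -(single (2 : ℤ) (1 : ℂ) • laurentDerivation)

theorem coe_inftyDerivation : ⇑inftyDerivation = derivAtInfty := rfl

theorem derivAtInfty_single_mul (n : ℤ) (p : PowerSeries ℂ) :
    derivAtInfty (single n (1 : ℂ) * ofPowerSeries ℤ ℂ p) =
      single (n + 1) (1 : ℂ) * ofPowerSeries ℤ ℂ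
        (-(PowerSeries.C (n : ℂ) * p + PowerSeries.X * PowerSeries.derivative ℂ p)) := by
  rw [derivAtInfty, laurent_derivative_single_mul, ← mul_assoc, single_mul_single, map_neg,
    mul_one, show (2 : ℤ) + (n - 1) = n + 1 by ring]
  exact neg_mul_eq_mul_neg (_ : LaurentSeries ℂ) _

theorem laurent_derivative_single (n : ℤ) :
    LaurentSeries.derivative ℂ (single n (1 : ℂ)) = single (n - 1) (n : ℂ) := by
  simp [LaurentSeries.derivative_apply]

theorem inftyDerivation_single_neg_one : inftyDerivation (single (-1 : ℤ) (1 : ℂ)) = 1 := by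
  rw [coe_inftyDerivation, derivAtInfty, laurent_derivative_single, single_mul_single]
  ext k
  simp [HahnSeries.coeff_one]

end LaurentDerivation

/-! ### Embedding rational functions in a differential field -/

section RatFuncHom

variable {L : Type*} [Field L] [Algebra ℂ L]

/-- Substitution of a transcendental element of a field for the variable of rational functions. -/
noncomputable def ratFuncSubst (x : L) (hx : Function.Injective (aeval (R := ℂ) x)) :
    RatFunc ℂ →+* L :=
  RatFunc.liftRingHom (aeval (R := ℂ) x : ℂ[X] →+* L)
    (nonZeroDivisors_le_comap_nonZeroDivisors_of_injective _ hx)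

variable {x : L}

/-- An element of derivative `1` is transcendental. -/
theorem aeval_injective_of_derivation_eq_one (D : Derivation ℂ L L) (hD : D x = 1) :
    Function.Injective (aeval (R := ℂ) x) := by
  have key (d : ℕ) : ∀ p : ℂ[X], p.natDegree ≤ d → aeval x p = 0 → p = 0 := by
    induction d with
    | zero =>
      intro p hp h
      rw [eq_C_of_natDegree_le_zero hp] at h ⊢
      simpa using h
    | succ d ih =>
      intro p hp h
      -- Applying `D` to `p(x) = 0` gives `p'(x) = 0`, a relation of lower degree.
      have h' : derivative p = 0 := by
        refine ih _ ((natDegree_derivative_le p).trans (by omega)) ?_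
        have := D.map_aeval p x
        rwa [h, map_zero, hD, smul_eq_mul, mul_one, eq_comm] at this
      rw [eq_C_of_derivative_eq_zero h'] at h ⊢
      simpa using h
  exact (injective_iff_map_eq_zero _).2 fun p => key _ p le_rfl

variable (hx : Function.Injective (aeval (R := ℂ) x))

theorem ratFuncSubst_algebraMap (p : ℂ[X]) :
    ratFuncSubst x hx (algebraMap ℂ[X] (RatFunc ℂ) p) = aeval x p := by
  simp [ratFuncSubst]

theorem ratFuncSubst_X : ratFuncSubst x hx RatFunc.X = x := by
  rw [← RatFunc.algebraMap_X, ratFuncSubst_algebraMap, aeval_X]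

/-- The chain rule with `D x = 1`. It allows differential identities to be transported between
rational functions and their expansions. -/
theorem ratFuncSubst_ratDeriv (D : Derivation ℂ L L) (hD : D x = 1) (f : RatFunc ℂ) :
    ratFuncSubst x hx (ratDeriv f) = D (ratFuncSubst x hx f) := by
  conv_rhs => rw [← RatFunc.num_div_denom f]
  rw [ratDeriv, map_div₀, map_div₀, Derivation.leibniz_div]
  simp only [ratFuncSubst_algebraMap, Derivation.map_aeval, hD, map_sub, map_mul, map_pow,
    smul_eq_mul, mul_one]
  ring

theorem aeval_single_neg_one (p : ℂ[X]) :
    aeval (HahnSeries.single (-1 : ℤ) (1 : ℂ)) p =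
      HahnSeries.single (-(p.natDegree : ℤ)) (1 : ℂ) *
        HahnSeries.ofPowerSeries ℤ ℂ (p.reverse : PowerSeries ℂ) := by
  let t : LaurentSeries ℂ := HahnSeries.single (1 : ℤ) (1 : ℂ)
  let s : LaurentSeries ℂ := HahnSeries.single (-1 : ℤ) (1 : ℂ)
  have hts : t * s = 1 := by simp [t, s]
  have hst : s * t = 1 := by simp [t, s]
  let i : Invertible s := ⟨t, hts, hst⟩
  have h := eval₂_reverse_mul_pow (algebraMap ℂ (LaurentSeries ℂ)) s p
  have h1 : s ^ p.natDegree = HahnSeries.single (-(p.natDegree : ℤ)) (1 : ℂ) := by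
    simp [s, HahnSeries.single_pow]
  have h2 (q : ℂ[X]) : eval₂ (algebraMap ℂ (LaurentSeries ℂ)) t q =
      HahnSeries.ofPowerSeries ℤ ℂ (q : PowerSeries ℂ) := by
    induction q using Polynomial.induction_on' with
    | add p q hp hq => simp [hp, hq]
    | monomial n a =>
      rw [eval₂_monomial, ← C_mul_X_pow_eq_monomial, coe_mul, coe_C, coe_pow, coe_X, map_mul, map_pow,
        HahnSeries.ofPowerSeries_C, HahnSeries.ofPowerSeries_X]
      rfl
  rw [h1, show ⅟s = t from rfl, h2] at h
  rw [mul_comm, h]; rfl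

end RatFuncHom

/-! ### Expansion at infinity -/

section RatDerivation

theorem inftySubst_injective :
    Function.Injective (aeval (R := ℂ) (HahnSeries.single (-1 : ℤ) (1 : ℂ))) :=
  aeval_injective_of_derivation_eq_one inftyDerivation inftyDerivation_single_neg_one

/-- Expansion of rational functions at infinity in powers of `1 / z`. -/
noncomputable def expandAtInfty : RatFunc ℂ →+* LaurentSeries ℂ :=
  ratFuncSubst (HahnSeries.single (-1 : ℤ) (1 : ℂ)) inftySubst_injective

theorem expandAtInfty_ratDeriv (f : RatFunc ℂ) :
    expandAtInfty (ratDeriv f) = derivAtInfty (expandAtInfty f) :=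
  ratFuncSubst_ratDeriv _ inftyDerivation inftyDerivation_single_neg_one f

/-- Differentiation of rational functions as a derivation. -/
noncomputable def ratDerivation : Derivation ℂ (RatFunc ℂ) (RatFunc ℂ) :=
  Derivation.mk'
    { toFun := ratDeriv
      -- The derivation laws are checked after the injective expansion at infinity, where they are
      -- known.
      map_add' := fun f g => expandAtInfty.injective <| by
        simp only [map_add, expandAtInfty_ratDeriv, ← coe_inftyDerivation]
      map_smul' := fun c f => expandAtInfty.injective <| by
        have h : expandAtInfty (algebraMap ℂ (RatFunc ℂ) c) = algebraMap ℂ _ c := by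
          rw [IsScalarTower.algebraMap_apply ℂ ℂ[X] (RatFunc ℂ), expandAtInfty,
            ratFuncSubst_algebraMap, algebraMap_eq, aeval_C]
        simp only [Algebra.smul_def, map_mul, expandAtInfty_ratDeriv, ← coe_inftyDerivation, h,
          Derivation.leibniz, Derivation.map_algebraMap, RingHom.id_apply, smul_eq_mul, mul_zero,
          add_zero] }
    fun f g => expandAtInfty.injective <| by
      simp only [LinearMap.coe_mk, AddHom.coe_mk, smul_eq_mul, map_add, map_mul,
        expandAtInfty_ratDeriv, ← coe_inftyDerivation, Derivation.leibniz]

theorem coe_ratDerivation : ⇑ratDerivation = ratDeriv := rfl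

theorem ratDeriv_algebraMap (p : ℂ[X]) :
    ratDeriv (algebraMap ℂ[X] (RatFunc ℂ) p) =
      algebraMap ℂ[X] (RatFunc ℂ) (derivative p) := by
  simp [ratDeriv]

end RatDerivation

/-! ### Rational solutions of the bilinear equation have no poles -/

section Polynomiality

open HahnSeries

/-- The lowest-order coefficient gives the indicial equation `r(r-1) - 2rm + m(m-1) = 0`. -/
theorem order_relation_of_bilinear {r m : ℤ} {p q : PowerSeries ℂ}
    (hp : PowerSeries.constantCoeff p ≠ 0) (hq : PowerSeries.constantCoeff q ≠ 0)
    {x y : LaurentSeries ℂ} (hx : x = single r (1 : ℂ) * ofPowerSeries ℤ ℂ p)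
    (hy : y = single m (1 : ℂ) * ofPowerSeries ℤ ℂ q)
    (h : laurentDerivation (laurentDerivation x) * y
      - 2 * laurentDerivation x * laurentDerivation y
      + x * laurentDerivation (laurentDerivation y) = 0) :
    (r - m) ^ 2 = r + m := by
  have hD (n : ℤ) (p : PowerSeries ℂ) :
      laurentDerivation (single n (1 : ℂ) * ofPowerSeries ℤ ℂ p) = _ :=
    laurent_derivative_single_mul n p
  obtain ⟨s, hs⟩ : ∃ s : ℤ → LaurentSeries ℂ, s = fun n => single n (1 : ℂ) := ⟨_, rfl⟩
  have hsa (a b : ℤ) : s (a + b) = s a * s b := by simp [hs]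
  have hs1 (n : ℤ) : single n (1 : ℂ) = s n := by rw [hs]
  rw [hx, hy, hD, hD, hD, hD] at h
  simp only [hs1] at h
  set p1 := PowerSeries.C (r : ℂ) * p + PowerSeries.X * PowerSeries.derivative ℂ p with hp1
  set q1 := PowerSeries.C (m : ℂ) * q + PowerSeries.X * PowerSeries.derivative ℂ q with hq1
  set p2 := PowerSeries.C ((r - 1 : ℤ) : ℂ) * p1 + PowerSeries.X * PowerSeries.derivative ℂ p1
    with hp2
  set q2 := PowerSeries.C ((m - 1 : ℤ) : ℂ) * q1 + PowerSeries.X * PowerSeries.derivative ℂ q1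
    with hq2
  have e1 (n : ℤ) : s (n - 1) = s n * s (-1) := by rw [← hsa]; rfl
  have hprod : s r * s m * s (-1) * s (-1) *
      ofPowerSeries ℤ ℂ (p2 * q - 2 * p1 * q1 + p * q2) = 0 := by
    rw [← h]
    simp only [e1, map_add, map_sub, map_mul, map_ofNat]
    ring
  have hs0 (n : ℤ) : s n ≠ 0 := by simp [hs]
  have h0 : p2 * q - 2 * p1 * q1 + p * q2 = 0 := by
    apply ofPowerSeries_injective (Γ := ℤ)
    simpa [hs0] using hprod
  have hc := congrArg PowerSeries.constantCoeff h0
  simp only [hp2, hq2, hp1, hq1, map_add, map_sub, map_mul, map_ofNat, PowerSeries.constantCoeff_C,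
    PowerSeries.constantCoeff_X, zero_mul, add_zero, map_zero] at hc
  have : PowerSeries.constantCoeff p * PowerSeries.constantCoeff q *
      (((r - m) ^ 2 - (r + m) : ℤ) : ℂ) = 0 := by
    push_cast at hc ⊢
    linear_combination hc
  have h2 : (r - m) ^ 2 - (r + m) = 0 := by
    simpa only [mul_eq_zero, hp, hq, false_or, Int.cast_eq_zero] using this
  linarith

theorem laurentDerivation_C_add_single (a : ℂ) :
    laurentDerivation (algebraMap ℂ (LaurentSeries ℂ) a + single (1 : ℤ) (1 : ℂ)) = 1 := by
  rw [map_add, Derivation.map_algebraMap, zero_add]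
  exact (laurent_derivative_single 1).trans (by simp)

/-- The Taylor expansion of rational functions at a point. -/
noncomputable def expandAt (a : ℂ) : RatFunc ℂ →+* LaurentSeries ℂ :=
  ratFuncSubst (algebraMap ℂ (LaurentSeries ℂ) a + single (1 : ℤ) (1 : ℂ))
    (aeval_injective_of_derivation_eq_one laurentDerivation (laurentDerivation_C_add_single a))

theorem expandAt_ratDeriv (a : ℂ) (f : RatFunc ℂ) :
    expandAt a (ratDeriv f) = laurentDerivation (expandAt a f) :=
  ratFuncSubst_ratDeriv _ laurentDerivation (laurentDerivation_C_add_single a) f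

theorem exists_expandAt_algebraMap (a : ℂ) (p : ℂ[X]) :
    ∃ q : PowerSeries ℂ, PowerSeries.constantCoeff q = p.eval a ∧
      expandAt a (algebraMap ℂ[X] (RatFunc ℂ) p) = ofPowerSeries ℤ ℂ q := by
  refine ⟨eval₂ PowerSeries.C (PowerSeries.C a + PowerSeries.X) p, ?_, ?_⟩
  · rw [hom_eval₂, map_add, PowerSeries.constantCoeff_X, PowerSeries.constantCoeff_C, add_zero,
      eval, show PowerSeries.constantCoeff.comp PowerSeries.C = RingHom.id ℂ from
        RingHom.ext PowerSeries.constantCoeff_C]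
  · rw [expandAt, ratFuncSubst_algebraMap, hom_eval₂, map_add, ofPowerSeries_X, ofPowerSeries_C,
      show (ofPowerSeries ℤ ℂ).comp PowerSeries.C = algebraMap ℂ (LaurentSeries ℂ) from
        RingHom.ext ofPowerSeries_C]
    rfl

/-- Rational solutions of the bilinear equation `R'' T - 2 R' T' + R T'' = 0` are polynomials. -/
theorem exists_polynomial_of_bilinear {R T : RatFunc ℂ} (hR : R ≠ 0) (hT : T ≠ 0)
    (h : ratDeriv (ratDeriv R) * T - 2 * ratDeriv R * ratDeriv T + R * ratDeriv (ratDeriv T) = 0) :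
    ∃ p : ℂ[X], algebraMap ℂ[X] (RatFunc ℂ) p = R := by
  have hden (a : ℂ) : R.denom.eval a ≠ 0 := by
    intro ha
    obtain ⟨r, p, hp, hx⟩ := exists_eq_single_mul (expandAt a R) (by simpa using hR)
    obtain ⟨m, q, hq, hy⟩ := exists_eq_single_mul (expandAt a T) (by simpa using hT)
    have hrm : (r - m) ^ 2 = r + m := by
      refine order_relation_of_bilinear hp hq hx hy ?_
      have := congrArg (expandAt a) h
      simpa only [map_add, map_sub, map_mul, map_ofNat, expandAt_ratDeriv, map_zero] using this
    -- With `d = r - m` the relation gives `r = d(d+1)/2`, which is nonnegative for every integer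
    -- `d`.
    have hr : 0 ≤ r := by
      rcases le_or_gt 0 (r - m) with h1 | h1 <;> nlinarith
    lift r to ℕ using hr
    obtain ⟨u, hu, hu'⟩ := exists_expandAt_algebraMap a R.num
    obtain ⟨v, hv, hv'⟩ := exists_expandAt_algebraMap a R.denom
    have hnum : R * algebraMap ℂ[X] (RatFunc ℂ) R.denom = algebraMap ℂ[X] (RatFunc ℂ) R.num := by
      conv_lhs => enter [1]; rw [← RatFunc.num_div_denom R]
      exact div_mul_cancel₀ _ (RatFunc.algebraMap_ne_zero R.denom_ne_zero)
    -- Since `R` is regular at `a`, a zero of the denominator would be one of the numerator too,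
    -- against coprimality.
    have huv : PowerSeries.X ^ r * p * v = u := by
      apply ofPowerSeries_injective (Γ := ℤ)
      rw [map_mul, map_mul, ofPowerSeries_X_pow, ← hx, ← hu', ← hv', ← map_mul, hnum]
    have hnum0 : R.num.eval a = 0 := by
      rw [← hu, ← huv, map_mul, hv, ha, mul_zero]
    obtain ⟨b, c, hbc⟩ := R.isCoprime_num_denom
    have := congrArg (eval a) hbc
    simp [hnum0, ha] at this
  have hdeg : R.denom.degree = 0 := by
    by_contra hd
    obtain ⟨a, ha⟩ := IsAlgClosed.exists_root R.denom hd
    exact hden a ha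
  have h1 : R.denom = 1 :=
    (Monic.natDegree_eq_zero R.monic_denom).1 (natDegree_eq_of_degree_eq_some hdeg)
  refine ⟨R.num, ?_⟩
  conv_rhs => rw [← RatFunc.num_div_denom R, h1, map_one, div_one]

end Polynomiality

/-! ### Existence of the special polynomials -/

section SpecialPolynomials

/-- Consecutive tau functions `S`, `T`: `w = (ln (S / T))'` solves the sixth-order equation with
parameter `n`, and its Miura transform is `2 (ln S)''`. -/
structure IsTauPair (n : ℕ) (S T : RatFunc ℂ) : Prop where
  fst_ne_zero : S ≠ 0
  snd_ne_zero : T ≠ 0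
  solves : sixthOrderP2 ratDeriv RatFunc.X (n : RatFunc ℂ) (ratDeriv S / S - ratDeriv T / T) = 0
  miura : ratDeriv (ratDeriv S / S - ratDeriv T / T) - (ratDeriv S / S - ratDeriv T / T) ^ 2 =
    2 * ratDeriv (ratDeriv S / S)

theorem ratDeriv_X : ratDeriv RatFunc.X = 1 := by
  rw [← RatFunc.algebraMap_X, ratDeriv_algebraMap, derivative_X, map_one]

theorem sixthOrderP2_zero {R : Type*} [CommRing R] {D : R → R} (hD : D 0 = 0) (z : R) :
    sixthOrderP2 D z 0 0 = 0 := by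
  simp [sixthOrderP2, hD]

theorem isTauPair_zero : IsTauPair 0 1 1 := by
  have h0 : ratDeriv 0 = 0 := by rw [← coe_ratDerivation, map_zero]
  have h1 : ratDeriv 1 / 1 = 0 := by
    rw [← coe_ratDerivation, Derivation.map_one_eq_zero, zero_div]
  refine ⟨one_ne_zero, one_ne_zero, ?_, ?_⟩
  · rw [h1, sub_self, Nat.cast_zero]
    exact sixthOrderP2_zero h0 _
  · rw [h1, sub_self, h0, mul_zero, sub_eq_zero, eq_comm, sq, mul_zero]

theorem exists_isTauPair_succ {n : ℕ} {S T : RatFunc ℂ} (h : IsTauPair n S T) :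
    ∃ R, IsTauPair (n + 1) T R := by
  obtain ⟨R, hR, h1, h2⟩ := exists_backlund ratDerivation ratDeriv_X h.fst_ne_zero h.snd_ne_zero n
    h.solves h.miura
  exact ⟨R, h.snd_ne_zero, hR, h1, h2⟩

theorem exists_tau_sequence :
    ∃ S T : ℕ → RatFunc ℂ, T 0 = 1 ∧ (∀ n, S (n + 1) = T n) ∧ ∀ n, IsTauPair n (S n) (T n) := by
  have step (n : ℕ) (p : {p : RatFunc ℂ × RatFunc ℂ // IsTauPair n p.1 p.2}) :
      ∃ q : {p : RatFunc ℂ × RatFunc ℂ // IsTauPair (n + 1) p.1 p.2}, q.1.1 = p.1.2 := by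
    obtain ⟨R, hR⟩ := exists_isTauPair_succ p.2
    exact ⟨⟨(_, R), hR⟩, rfl⟩
  choose g hg using step
  let f : ∀ n, {p : RatFunc ℂ × RatFunc ℂ // IsTauPair n p.1 p.2} :=
    fun n => Nat.rec ⟨(1, 1), isTauPair_zero⟩ g n
  exact ⟨fun n => (f n).1.1, fun n => (f n).1.2, rfl, fun n => hg n (f n), fun n => (f n).2⟩

theorem ratLogDeriv_C_mul {c : ℂ} (hc : c ≠ 0) (p : ℂ[X]) :
    ratLogDeriv (C c * p) = ratLogDeriv p := by
  have : algebraMap ℂ[X] (RatFunc ℂ) (C c) ≠ 0 := RatFunc.algebraMap_ne_zero (by simpa using hc)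
  rw [ratLogDeriv, derivative_C_mul, map_mul, map_mul, mul_div_mul_left _ _ this, ratLogDeriv]

theorem exists_isSpecialPolynomials : ∃ Q : ℕ → ℂ[X], IsSpecialPolynomials Q := by
  obtain ⟨S, T, hT0, hST, h⟩ := exists_tau_sequence
  have hpol (n : ℕ) : ∃ p : ℂ[X], algebraMap ℂ[X] (RatFunc ℂ) p = T n := by
    -- The bilinear equation is symmetric, so it is used with the roles of `S` and `T` exchanged.
    refine exists_polynomial_of_bilinear (h n).snd_ne_zero (h n).fst_ne_zero ?_
    have := bilinear_of_miura ratDerivation (h n).fst_ne_zero (h n).snd_ne_zero (h n).miura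
    rw [coe_ratDerivation] at this
    linear_combination this
  choose p hp using hpol
  have hp0 (n : ℕ) : p n ≠ 0 := by
    intro h0
    exact (h n).snd_ne_zero (by rw [← hp, h0, map_zero])
  have hlog (n : ℕ) : ratLogDeriv (C (p n).leadingCoeff⁻¹ * p n) = ratDeriv (T n) / T n := by
    rw [ratLogDeriv_C_mul (by simpa using hp0 n), ratLogDeriv, ← ratDeriv_algebraMap, hp]
  refine ⟨fun n => C (p n).leadingCoeff⁻¹ * p n, ?_, fun n => ?_, fun n hn => ?_⟩
  · have : p 0 = 1 := RatFunc.algebraMap_injective ℂ (by rw [hp, hT0, map_one])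
    simp [this]
  · rw [Monic, leadingCoeff_mul, leadingCoeff_C, inv_mul_cancel₀ (by simpa using hp0 n)]
  · obtain ⟨k, rfl⟩ := Nat.exists_eq_succ_of_ne_zero (Nat.one_le_iff_ne_zero.1 hn)
    simp only [hlog, Nat.succ_eq_add_one, Nat.add_sub_cancel]
    rw [← hST]
    exact (h (k + 1)).solves

end SpecialPolynomials

/-! ### The formal solution at infinity as a fixed point -/

section FormalSolution

/-- `D (t ^ (k + 1) g) = t ^ (k + 2) (scaledDeriv k g)` for `D = d/dz` at infinity, `t = 1 / z`. -/
noncomputable def scaledDeriv (k : ℕ) (g : PowerSeries ℂ) : PowerSeries ℂ :=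
  -(PowerSeries.C ((k : ℂ) + 1) * g + PowerSeries.X * PowerSeries.derivative ℂ g)

/-- The series `z ^ (k + 1) D^k (f / z)`. -/
noncomputable def scaledIterate (f : PowerSeries ℂ) : ℕ → PowerSeries ℂ
  | 0 => f
  | k + 1 => scaledDeriv k (scaledIterate f k)

theorem derivAtInfty_iterate (f : PowerSeries ℂ) (k : ℕ) :
    derivAtInfty^[k] (HahnSeries.ofPowerSeries ℤ ℂ (PowerSeries.X * f)) =
      HahnSeries.ofPowerSeries ℤ ℂ (PowerSeries.X ^ (k + 1) * scaledIterate f k) := by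
  induction k with
  | zero => simp [scaledIterate]
  | succ k ih =>
    rw [Function.iterate_succ_apply', ih, map_mul, map_mul, HahnSeries.ofPowerSeries_X_pow,
      derivAtInfty_single_mul, HahnSeries.ofPowerSeries_X_pow, scaledIterate, scaledDeriv]
    push_cast
    rfl

/-- The terms of the sixth-order equation of weight seven, divided by `t ^ 7`. -/
noncomputable def weightSevenPart (f : PowerSeries ℂ) : PowerSeries ℂ :=
  scaledIterate f 6 - 14 * scaledIterate f 0 ^ 2 * scaledIterate f 4
    - 56 * scaledIterate f 0 * scaledIterate f 1 * scaledIterate f 3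
    - 42 * scaledIterate f 0 * scaledIterate f 2 ^ 2
    - 70 * scaledIterate f 1 ^ 2 * scaledIterate f 2
    + 70 * scaledIterate f 0 ^ 4 * scaledIterate f 2
    + 140 * scaledIterate f 0 ^ 3 * scaledIterate f 1 ^ 2 - 20 * scaledIterate f 0 ^ 7

/-- The fixed points of this map are the solutions of the equation divided by `t`. -/
noncomputable def formalStep (α : ℂ) (f : PowerSeries ℂ) : PowerSeries ℂ :=
  PowerSeries.X ^ 7 * weightSevenPart f - PowerSeries.C α

/-- Each term other than `z w` and `α` has weight seven, so it is `t⁷` times a power series, while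
`z w` is the series `f` itself. -/
theorem isExpansionAtInfty_iff (α : ℂ) (c : ℕ → ℂ) :
    IsExpansionAtInfty α c ↔ PowerSeries.mk c = formalStep α (PowerSeries.mk c) := by
  set f := PowerSeries.mk c
  have hz : HahnSeries.single (-1 : ℤ) (1 : ℂ) *
      HahnSeries.ofPowerSeries ℤ ℂ (PowerSeries.X * f) = HahnSeries.ofPowerSeries ℤ ℂ f := by
    rw [map_mul, ← mul_assoc, HahnSeries.ofPowerSeries_X, HahnSeries.single_mul_single]
    simp
  have key : sixthOrderP2 derivAtInfty (HahnSeries.single (-1 : ℤ) (1 : ℂ)) (HahnSeries.C α)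
      (seriesAtInfty c) = HahnSeries.ofPowerSeries ℤ ℂ (formalStep α f - f) := by
    rw [sixthOrderP2, seriesAtInfty, hz, ← HahnSeries.ofPowerSeries_C]
    have h0 := derivAtInfty_iterate f 0
    have h1 := derivAtInfty_iterate f 1
    rw [Function.iterate_zero, id_eq] at h0
    rw [Function.iterate_one] at h1
    rw [derivAtInfty_iterate, derivAtInfty_iterate, derivAtInfty_iterate, derivAtInfty_iterate,
      h1, h0]
    simp only [formalStep, weightSevenPart, map_sub, map_add, map_mul, map_pow, map_ofNat]
    ring
  rw [IsExpansionAtInfty, key, map_eq_zero_iff _ HahnSeries.ofPowerSeries_injective, sub_eq_zero,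
    eq_comm]

theorem X_pow_dvd_derivative {k : ℕ} {h : PowerSeries ℂ} (hk : PowerSeries.X ^ k ∣ h) :
    PowerSeries.X ^ k ∣ PowerSeries.X * PowerSeries.derivative ℂ h := by
  rw [PowerSeries.X_pow_dvd_iff] at hk ⊢
  intro m hm
  cases m with
  | zero => simp
  | succ m => rw [PowerSeries.coeff_succ_X_mul, PowerSeries.coeff_derivative, hk _ hm, zero_mul]

theorem X_pow_dvd_scaledIterate_sub {k : ℕ} {f g : PowerSeries ℂ} (h : PowerSeries.X ^ k ∣ f - g)
    (j : ℕ) : PowerSeries.X ^ k ∣ scaledIterate f j - scaledIterate g j := by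
  induction j with
  | zero => exact h
  | succ j ih =>
    have : scaledIterate f (j + 1) - scaledIterate g (j + 1) =
        -(PowerSeries.C ((j : ℂ) + 1) * (scaledIterate f j - scaledIterate g j) +
          PowerSeries.X * PowerSeries.derivative ℂ (scaledIterate f j - scaledIterate g j)) := by
      simp only [scaledIterate, scaledDeriv, map_sub]; ring
    rw [this, dvd_neg]
    exact dvd_add (ih.mul_left _) (X_pow_dvd_derivative ih)

theorem X_pow_dvd_formalStep_sub (α : ℂ) {k : ℕ} {f g : PowerSeries ℂ}
    (h : PowerSeries.X ^ k ∣ f - g) :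
    PowerSeries.X ^ (k + 1) ∣ formalStep α f - formalStep α g := by
  -- `weightSevenPart` is a polynomial in the scaled iterates, so congruence modulo `X ^ k` passes
  -- through it in the quotient ring.
  have hs (j : ℕ) : Ideal.Quotient.mk (Ideal.span {(PowerSeries.X : PowerSeries ℂ) ^ k})
      (scaledIterate f j) = Ideal.Quotient.mk _ (scaledIterate g j) := by
    rw [Ideal.Quotient.eq, Ideal.mem_span_singleton]
    exact X_pow_dvd_scaledIterate_sub h j
  have hw : PowerSeries.X ^ k ∣ weightSevenPart f - weightSevenPart g := by
    rw [← Ideal.mem_span_singleton, ← Ideal.Quotient.eq]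
    simp only [weightSevenPart, map_sub, map_add, map_mul, map_pow, hs]
  rw [formalStep, formalStep, sub_sub_sub_cancel_right, ← mul_sub]
  have := mul_dvd_mul (pow_dvd_pow (PowerSeries.X : PowerSeries ℂ) (show 1 ≤ 7 by norm_num)) hw
  rwa [← pow_add, add_comm] at this

theorem X_pow_dvd_sub_iterate {Ψ : PowerSeries ℂ → PowerSeries ℂ}
    (hΨ : ∀ k f g, PowerSeries.X ^ k ∣ f - g → PowerSeries.X ^ (k + 1) ∣ Ψ f - Ψ g)
    {f : PowerSeries ℂ} (hf : f = Ψ f) (k : ℕ) : PowerSeries.X ^ k ∣ f - Ψ^[k] 0 := by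
  induction k with
  | zero => simp
  | succ k ih =>
    rw [Function.iterate_succ_apply']
    nth_rw 1 [hf]
    exact hΨ _ _ _ ih

theorem coeff_eq_coeff_iterate {Ψ : PowerSeries ℂ → PowerSeries ℂ}
    (hΨ : ∀ k f g, PowerSeries.X ^ k ∣ f - g → PowerSeries.X ^ (k + 1) ∣ Ψ f - Ψ g)
    {f : PowerSeries ℂ} (hf : f = Ψ f) (m : ℕ) :
    PowerSeries.coeff m f = PowerSeries.coeff m (Ψ^[m + 1] 0) := by
  have := PowerSeries.X_pow_dvd_iff.1 (X_pow_dvd_sub_iterate hΨ hf (m + 1)) m m.lt_succ_self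
  rwa [map_sub, sub_eq_zero] at this

/-- A map that is contracting in the adic topology has a fixed point. -/
theorem exists_fixedPoint_of_contracting {Ψ : PowerSeries ℂ → PowerSeries ℂ}
    (hΨ : ∀ k f g, PowerSeries.X ^ k ∣ f - g → PowerSeries.X ^ (k + 1) ∣ Ψ f - Ψ g) :
    ∃ f, f = Ψ f := by
  have hstep (k : ℕ) : PowerSeries.X ^ k ∣ Ψ^[k + 1] 0 - Ψ^[k] 0 := by
    induction k with
    | zero => simp
    | succ k ih =>
      have := hΨ _ _ _ ih
      rwa [← Function.iterate_succ_apply' Ψ, ← Function.iterate_succ_apply' Ψ] at this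
  have hmono (k j : ℕ) : PowerSeries.X ^ k ∣ Ψ^[k + j] 0 - Ψ^[k] 0 := by
    induction j with
    | zero => simp
    | succ j ih =>
      have := dvd_add ((pow_dvd_pow _ (Nat.le_add_right k j)).trans (hstep (k + j))) ih
      rwa [sub_add_sub_cancel] at this
  -- The `m`-th coefficient of the iterates is stable from iterate `m + 1` on.
  set f : PowerSeries ℂ := PowerSeries.mk fun m => PowerSeries.coeff m (Ψ^[m + 1] 0) with hf
  have happrox (k : ℕ) : PowerSeries.X ^ k ∣ f - Ψ^[k] 0 := by
    rw [PowerSeries.X_pow_dvd_iff]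
    intro m hm
    obtain ⟨j, rfl⟩ := Nat.exists_eq_add_of_le (Nat.succ_le_of_lt hm)
    have := PowerSeries.X_pow_dvd_iff.1 (hmono (m + 1) j) m m.lt_succ_self
    rw [map_sub, sub_eq_zero] at this ⊢
    rw [Nat.succ_eq_add_one, this, hf, PowerSeries.coeff_mk]
  refine ⟨f, ?_⟩
  ext m
  have h1 := PowerSeries.X_pow_dvd_iff.1 (happrox (m + 1)) m m.lt_succ_self
  have h2 := PowerSeries.X_pow_dvd_iff.1 (hΨ _ _ _ (happrox m)) m m.lt_succ_self
  rw [← Function.iterate_succ_apply' Ψ] at h2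
  rw [map_sub, sub_eq_zero] at h1 h2
  rw [h1, h2]

/-- Power series with exponents divisible by seven. -/
noncomputable def sevenSubring : Subring (PowerSeries ℂ) where
  carrier := {f | ∀ m, ¬ 7 ∣ m → PowerSeries.coeff m f = 0}
  mul_mem' := fun {f g} hf hg m hm => by
    rw [PowerSeries.coeff_mul]
    refine Finset.sum_eq_zero fun x hx => ?_
    rw [Finset.HasAntidiagonal.mem_antidiagonal] at hx
    by_cases h : 7 ∣ x.1
    · rw [hg x.2 (fun h' => hm (hx ▸ dvd_add h h')), mul_zero]
    · rw [hf x.1 h, zero_mul]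
  one_mem' := fun m hm => by
    rw [PowerSeries.coeff_one, if_neg]
    rintro rfl
    exact hm (dvd_zero _)
  add_mem' := fun {f g} hf hg m hm => by rw [map_add, hf m hm, hg m hm, add_zero]
  zero_mem' := fun m _ => map_zero _
  neg_mem' := fun {f} hf m hm => by rw [map_neg, hf m hm, neg_zero]

theorem C_mem_sevenSubring (a : ℂ) : PowerSeries.C a ∈ sevenSubring := fun m hm => by
  rw [PowerSeries.coeff_C, if_neg]
  rintro rfl
  exact hm (dvd_zero _)

theorem X_pow_seven_mem_sevenSubring : PowerSeries.X ^ 7 ∈ sevenSubring := fun m hm => by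
  rw [PowerSeries.coeff_X_pow, if_neg]
  rintro rfl
  exact hm dvd_rfl

/-- Only the Euler operator `X d/dX` occurs, and it multiplies each coefficient by its exponent. -/
theorem scaledIterate_mem_sevenSubring {f : PowerSeries ℂ} (hf : f ∈ sevenSubring) (k : ℕ) :
    scaledIterate f k ∈ sevenSubring := by
  induction k with
  | zero => exact hf
  | succ k ih =>
    refine neg_mem (add_mem (mul_mem (C_mem_sevenSubring _) ih) fun m hm => ?_)
    cases m with
    | zero => simp
    | succ m => rw [PowerSeries.coeff_succ_X_mul, PowerSeries.coeff_derivative, ih _ hm, zero_mul]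

theorem formalStep_mem_sevenSubring (α : ℂ) {f : PowerSeries ℂ} (hf : f ∈ sevenSubring) :
    formalStep α f ∈ sevenSubring := by
  have h := scaledIterate_mem_sevenSubring hf
  refine sub_mem (mul_mem X_pow_seven_mem_sevenSubring ?_) (C_mem_sevenSubring _)
  have hn (n : ℕ) [n.AtLeastTwo] : (OfNat.ofNat n : PowerSeries ℂ) ∈ sevenSubring :=
    ofNat_mem sevenSubring n
  unfold weightSevenPart
  exact sub_mem (add_mem (add_mem (sub_mem (sub_mem (sub_mem (sub_mem (h 6)
    (mul_mem (mul_mem (hn 14) (pow_mem (h 0) 2)) (h 4)))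
    (mul_mem (mul_mem (mul_mem (hn 56) (h 0)) (h 1)) (h 3)))
    (mul_mem (mul_mem (hn 42) (h 0)) (pow_mem (h 2) 2)))
    (mul_mem (mul_mem (hn 70) (pow_mem (h 1) 2)) (h 2)))
    (mul_mem (mul_mem (hn 70) (pow_mem (h 0) 4)) (h 2)))
    (mul_mem (mul_mem (hn 140) (pow_mem (h 0) 3)) (pow_mem (h 1) 2)))
    (mul_mem (hn 20) (pow_mem (h 0) 7))

theorem existsUnique_isExpansionAtInfty (α : ℂ) : ∃! c : ℕ → ℂ, IsExpansionAtInfty α c := by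
  have hΨ (k f g) := X_pow_dvd_formalStep_sub α (k := k) (f := f) (g := g)
  obtain ⟨f, hf⟩ := exists_fixedPoint_of_contracting hΨ
  have hmk : PowerSeries.mk (fun m => PowerSeries.coeff m f) = f := by ext; simp
  refine ⟨fun m => PowerSeries.coeff m f, ?_, fun c hc => ?_⟩
  · refine (isExpansionAtInfty_iff _ _).2 ?_
    rw [hmk]
    exact hf
  · funext m
    replace hc := (isExpansionAtInfty_iff _ _).1 hc
    rw [coeff_eq_coeff_iterate hΨ hf, ← coeff_eq_coeff_iterate hΨ hc, PowerSeries.coeff_mk]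

/-- Each coefficient agrees with that of an iterate started at `0`, and all these iterates lie in
`sevenSubring`. -/
theorem IsExpansionAtInfty.eq_zero_of_not_dvd {α : ℂ} {c : ℕ → ℂ} (hc : IsExpansionAtInfty α c)
    {m : ℕ} (hm : ¬ 7 ∣ m) : c m = 0 := by
  rw [isExpansionAtInfty_iff] at hc
  have h := coeff_eq_coeff_iterate
    (fun k f g => X_pow_dvd_formalStep_sub α (k := k) (f := f) (g := g)) hc m
  rw [PowerSeries.coeff_mk] at h
  have hmem (k : ℕ) : (formalStep α)^[k] 0 ∈ sevenSubring := by
    induction k with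
    | zero => exact zero_mem _
    | succ k ih =>
      rw [Function.iterate_succ_apply']
      exact formalStep_mem_sevenSubring α ih
  rw [h, hmem _ m hm]

theorem IsExpansionAtInfty.coeff_zero {α : ℂ} {c : ℕ → ℂ} (hc : IsExpansionAtInfty α c) :
    c 0 = -α := by
  rw [isExpansionAtInfty_iff] at hc
  have := congrArg (PowerSeries.coeff 0) hc
  simpa only [formalStep, map_sub, PowerSeries.coeff_mk, PowerSeries.coeff_zero_eq_constantCoeff,
    map_mul, map_pow, PowerSeries.constantCoeff_X, PowerSeries.constantCoeff_C,
    zero_pow (show 7 ≠ 0 by norm_num), zero_mul, zero_sub] using this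

/-- The expansion for `α = 1` is that of the solution `-1 / z`. -/
theorem IsExpansionAtInfty.eq_zero_of_one {c : ℕ → ℂ} (hc : IsExpansionAtInfty 1 c) {m : ℕ}
    (hm : m ≠ 0) : c m = 0 := by
  have hmk : PowerSeries.mk (fun m => if m = 0 then (-1 : ℂ) else 0) = -1 := by
    ext m
    simp only [PowerSeries.coeff_mk, map_neg, PowerSeries.coeff_one]
    split_ifs <;> simp
  have h1 : IsExpansionAtInfty 1 fun m => if m = 0 then (-1 : ℂ) else 0 := by
    rw [isExpansionAtInfty_iff, hmk]
    have hd : PowerSeries.derivative ℂ (-1 : PowerSeries ℂ) = 0 := by simp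
    -- These are the coefficients of the successive derivatives of `-1/z`.
    have hs (k : ℕ) : scaledIterate (-1) k = PowerSeries.C ((-1) ^ (k + 1) * (k.factorial : ℂ)) := by
      induction k with
      | zero => simp [scaledIterate]
      | succ k ih =>
        rw [scaledIterate, ih, scaledDeriv, PowerSeries.derivative_C, mul_zero, add_zero, ← map_mul,
          ← map_neg, Nat.factorial_succ]
        congr 1
        push_cast
        ring
    have hw : weightSevenPart (-1) = 0 := by
      simp only [weightSevenPart, hs, ← map_ofNat PowerSeries.C, ← map_mul, ← map_pow, ← map_add,
        ← map_sub]
      norm_num [Nat.factorial]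
    rw [formalStep, hw, mul_zero, zero_sub, map_one]
  rw [(existsUnique_isExpansionAtInfty 1).unique hc h1]
  exact if_neg hm

end FormalSolution

/-! ### Coefficients of the polynomials from the expansions -/

section Coefficients

/-- Here `h` expands `z p'/p`. From `p = t^(-N) g`, with `g` the reversed polynomial, `z p'/p = N -
t g'/g`; `g` is invertible because `p` is monic. -/
theorem exists_expandAtInfty_ratLogDeriv {p : ℂ[X]} (hp : p.Monic) :
    ∃ h : PowerSeries ℂ,
      expandAtInfty (ratLogDeriv p) = HahnSeries.ofPowerSeries ℤ ℂ (PowerSeries.X * h) ∧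
      h * (p.reverse : PowerSeries ℂ) = PowerSeries.C (p.natDegree : ℂ) * (p.reverse : PowerSeries ℂ)
        - PowerSeries.X * PowerSeries.derivative ℂ (p.reverse : PowerSeries ℂ) := by
  set g : PowerSeries ℂ := (p.reverse : PowerSeries ℂ) with hg
  have hg0 : PowerSeries.constantCoeff g ≠ 0 := by
    rw [← PowerSeries.coeff_zero_eq_constantCoeff_apply, hg, Polynomial.coeff_coe,
      coeff_zero_reverse, hp.leadingCoeff]
    exact one_ne_zero
  have hexp : expandAtInfty (algebraMap ℂ[X] (RatFunc ℂ) p) =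
      HahnSeries.single (-(p.natDegree : ℤ)) (1 : ℂ) * HahnSeries.ofPowerSeries ℤ ℂ g := by
    rw [expandAtInfty, ratFuncSubst_algebraMap, aeval_single_neg_one]
  have hne : expandAtInfty (algebraMap ℂ[X] (RatFunc ℂ) p) ≠ 0 := by
    simpa using hp.ne_zero
  set e := PowerSeries.C (p.natDegree : ℂ) * g - PowerSeries.X * PowerSeries.derivative ℂ g
  have he : e * g⁻¹ * g = e := by rw [mul_assoc, PowerSeries.inv_mul_cancel g hg0, mul_one]
  refine ⟨e * g⁻¹, ?_, he⟩
  rw [ratLogDeriv, map_div₀, div_eq_iff hne, ← ratDeriv_algebraMap, expandAtInfty_ratDeriv, hexp,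
    derivAtInfty_single_mul, mul_left_comm, ← map_mul, mul_assoc, he, map_mul,
    HahnSeries.ofPowerSeries_X, ← mul_assoc, HahnSeries.single_mul_single, mul_one]
  congr 2
  simp only [e]
  push_cast
  rw [map_neg]
  ring

theorem expandAtInfty_sixthOrderP2 (n : ℕ) (w : RatFunc ℂ) :
    expandAtInfty (sixthOrderP2 ratDeriv RatFunc.X (n : RatFunc ℂ) w) =
      sixthOrderP2 derivAtInfty (HahnSeries.single (-1 : ℤ) (1 : ℂ)) (HahnSeries.C (n : ℂ))
        (expandAtInfty w) := by
  have hX : expandAtInfty RatFunc.X = HahnSeries.single (-1 : ℤ) (1 : ℂ) := ratFuncSubst_X _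
  simp only [sixthOrderP2, Function.iterate_succ, Function.iterate_zero, Function.comp_apply,
    id_eq, map_sub, map_add, map_mul, map_pow, map_ofNat, map_natCast, expandAtInfty_ratDeriv, hX]

variable {Q : ℕ → ℂ[X]} {c : ℂ → ℕ → ℂ}

/-- Each `w(z; i)` must expand to the unique formal solution, and the differences of logarithmic
derivatives telescope from `Q 0 = 1`. -/
theorem IsSpecialPolynomials.expandAtInfty_ratLogDeriv (hQ : IsSpecialPolynomials Q)
    (hc : ∀ α, IsExpansionAtInfty α (c α)) (n : ℕ) :
    expandAtInfty (ratLogDeriv (Q n)) = HahnSeries.ofPowerSeries ℤ ℂ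
      (PowerSeries.X * -∑ i ∈ Finset.Icc 1 n, PowerSeries.mk (c (i : ℂ))) := by
  induction n with
  | zero => simp [hQ.zero, ratLogDeriv]
  | succ n ih =>
    obtain ⟨h, hh, -⟩ := exists_expandAtInfty_ratLogDeriv (hQ.monic (n + 1))
    have hs := congrArg expandAtInfty (hQ.solves (n + 1) n.succ_pos)
    rw [expandAtInfty_sixthOrderP2, Nat.add_sub_cancel, map_sub, ih, hh, ← map_sub, ← mul_sub,
      map_zero] at hs
    set f := -∑ i ∈ Finset.Icc 1 n, PowerSeries.mk (c (i : ℂ)) - h with hf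
    have hmk : PowerSeries.mk (fun m => PowerSeries.coeff m f) = f := by ext; simp
    have hexp : IsExpansionAtInfty ((n + 1 : ℕ) : ℂ) fun m => PowerSeries.coeff m f := by
      rw [IsExpansionAtInfty, seriesAtInfty, hmk]
      exact hs
    have hcf := (existsUnique_isExpansionAtInfty _).unique (hc ((n + 1 : ℕ) : ℂ)) hexp
    rw [hh, Finset.sum_Icc_succ_top (Nat.le_add_left 1 n), hcf, hmk, hf]
    congr 2
    ring

theorem IsSpecialPolynomials.coeff_relation (hQ : IsSpecialPolynomials Q)
    (hc : ∀ α, IsExpansionAtInfty α (c α)) (n m : ℕ) :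
    ((m : ℂ) - (Q n).natDegree) * (Q n).reverse.coeff m =
      ∑ j ∈ Finset.range (m + 1),
        (∑ i ∈ Finset.Icc 1 n, c (i : ℂ) j) * (Q n).reverse.coeff (m - j) := by
  obtain ⟨h, hh, hrel⟩ := exists_expandAtInfty_ratLogDeriv (hQ.monic n)
  rw [hQ.expandAtInfty_ratLogDeriv hc] at hh
  have hh' := mul_left_cancel₀ PowerSeries.X_ne_zero (HahnSeries.ofPowerSeries_injective hh)
  rw [← hh'] at hrel
  have hX : PowerSeries.coeff m (PowerSeries.X *
      PowerSeries.derivative ℂ ((Q n).reverse : PowerSeries ℂ)) = m * (Q n).reverse.coeff m := by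
    cases m with
    | zero => simp
    | succ m =>
      rw [PowerSeries.coeff_succ_X_mul, PowerSeries.coeff_derivative, Polynomial.coeff_coe]
      push_cast
      ring
  have := congrArg (PowerSeries.coeff m) hrel
  rw [map_sub, hX, PowerSeries.coeff_C_mul, Polynomial.coeff_coe, neg_mul, map_neg,
    PowerSeries.coeff_mul, Finset.Nat.sum_antidiagonal_eq_sum_range_succ
      (fun a b => PowerSeries.coeff a (∑ i ∈ Finset.Icc 1 n, PowerSeries.mk (c (i : ℂ))) *
        PowerSeries.coeff b ((Q n).reverse : PowerSeries ℂ))] at this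
  simp only [map_sum, PowerSeries.coeff_mk, Polynomial.coeff_coe] at this
  linear_combination this

theorem IsSpecialPolynomials.natDegree_eq_neg_sum (hQ : IsSpecialPolynomials Q)
    (hc : ∀ α, IsExpansionAtInfty α (c α)) (n : ℕ) :
    ((Q n).natDegree : ℂ) = -∑ i ∈ Finset.Icc 1 n, c (i : ℂ) 0 := by
  have h := hQ.coeff_relation hc n 0
  rw [zero_add, Finset.sum_range_one, Nat.sub_zero, coeff_zero_reverse,
    (hQ.monic n).leadingCoeff] at h
  push_cast at h
  linear_combination -h

theorem IsSpecialPolynomials.natDegree_eq (hQ : IsSpecialPolynomials Q)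
    (hc : ∀ α, IsExpansionAtInfty α (c α)) (n : ℕ) : (Q n).natDegree = n * (n + 1) / 2 := by
  have h := hQ.natDegree_eq_neg_sum hc n
  simp only [(hc _).coeff_zero, Finset.sum_neg_distrib, neg_neg] at h
  have h' : (Q n).natDegree = ∑ i ∈ Finset.Icc 1 n, i := by
    apply Nat.cast_injective (R := ℂ)
    rw [h, Nat.cast_sum]
  have hsum : (∑ i ∈ Finset.Icc 1 n, i) * 2 = n * (n + 1) := by
    clear h h'
    induction n with
    | zero => simp
    | succ n ih => rw [Finset.sum_Icc_succ_top (Nat.le_add_left 1 n), add_mul, ih]; ring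
  omega

theorem IsSpecialPolynomials.coeffA_eq (hQ : IsSpecialPolynomials Q)
    (hc : ∀ α, IsExpansionAtInfty α (c α)) {n m : ℕ} (hm : m ≤ n * (n + 1) / 2) :
    coeffA Q n m = (Q n).reverse.coeff m := by
  have hd := hQ.natDegree_eq hc n
  rw [coeffA, coeff_reverse, revAt_le (hd ▸ hm), hd]

theorem IsSpecialPolynomials.coeffA_recursion (hQ : IsSpecialPolynomials Q)
    (hc : ∀ α, IsExpansionAtInfty α (c α)) {n m : ℕ} (h1 : 1 ≤ m) (hm : m ≤ n * (n + 1) / 2) :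
    coeffA Q n m = (∑ j ∈ Finset.Icc 1 m,
      (∑ i ∈ Finset.Icc 2 n, c (i : ℂ) j) * coeffA Q n (m - j)) / (m : ℂ) := by
  have hn : 1 ≤ n := by
    rw [Nat.one_le_iff_ne_zero]
    rintro rfl
    omega
  have hm0 : (m : ℂ) ≠ 0 := by exact_mod_cast (Nat.one_le_iff_ne_zero.1 h1)
  rw [eq_div_iff hm0, hQ.coeffA_eq hc hm]
  have h := hQ.coeff_relation hc n m
  -- The `j = 0` term is `-N A_{n,m}`, which cancels the degree on the left and leaves `m A_{n,m}`.
  rw [Finset.sum_range_eq_add_Ico _ m.succ_pos, hQ.natDegree_eq_neg_sum hc, Nat.sub_zero] at h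
  have hsum : ∑ j ∈ Finset.Ico 1 (m + 1),
      (∑ i ∈ Finset.Icc 1 n, c (i : ℂ) j) * (Q n).reverse.coeff (m - j) =
      ∑ j ∈ Finset.Icc 1 m, (∑ i ∈ Finset.Icc 2 n, c (i : ℂ) j) * coeffA Q n (m - j) := by
    refine Finset.sum_congr rfl fun j hj => ?_
    have hj1 : j ≠ 0 := by
      have := (Finset.mem_Icc.1 hj).1
      omega
    have hc1 := hc ((1 : ℕ) : ℂ)
    rw [Nat.cast_one] at hc1
    -- The `i = 1` summand drops out because `w(z; 1) = -1/z` has no further terms.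
    rw [hQ.coeffA_eq hc ((Nat.sub_le m j).trans hm), ← Finset.add_sum_Ioc_eq_sum_Icc hn,
      Nat.cast_one, hc1.eq_zero_of_one hj1, zero_add]
    rfl
  rw [hsum] at h
  linear_combination h

theorem IsSpecialPolynomials.coeffA_zero (hQ : IsSpecialPolynomials Q)
    (hc : ∀ α, IsExpansionAtInfty α (c α)) (n : ℕ) : coeffA Q n 0 = 1 := by
  rw [hQ.coeffA_eq hc (Nat.zero_le _), coeff_zero_reverse, (hQ.monic n).leadingCoeff]

theorem IsSpecialPolynomials.coeffA_eq_zero_of_not_dvd (hQ : IsSpecialPolynomials Q)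
    (hc : ∀ α, IsExpansionAtInfty α (c α)) {n : ℕ} (m : ℕ) :
    m ≤ n * (n + 1) / 2 → ¬ 7 ∣ m → coeffA Q n m = 0 := by
  induction m using Nat.strong_induction_on with
  | _ m ih =>
    intro hm h7
    have h1 : 1 ≤ m := by omega
    rw [hQ.coeffA_recursion hc h1 hm, Finset.sum_eq_zero, zero_div]
    intro j hj
    rw [Finset.mem_Icc] at hj
    -- If `7 ∣ j` then `7 ∤ m - j` and induction applies; otherwise the expansion coefficients
    -- vanish.
    by_cases h : 7 ∣ j
    · rw [ih (m - j) (by omega) (by omega) (by omega), mul_zero]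
    · rw [Finset.sum_eq_zero fun i _ => (hc _).eq_zero_of_not_dvd h, zero_mul]

/-- Degree and recursion depend only on the formal expansions, not on the sequence. -/
theorem IsSpecialPolynomials.unique {P : ℕ → ℂ[X]} (hP : IsSpecialPolynomials P)
    (hQ : IsSpecialPolynomials Q) : P = Q := by
  choose c hc using fun α => (existsUnique_isExpansionAtInfty α).exists
  have hcoeff (n m : ℕ) : m ≤ n * (n + 1) / 2 → coeffA P n m = coeffA Q n m := by
    induction m using Nat.strong_induction_on with
    | _ m ih =>
      intro hm
      rcases Nat.eq_zero_or_pos m with rfl | h1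
      · rw [hP.coeffA_zero hc, hQ.coeffA_zero hc]
      · rw [hP.coeffA_recursion hc h1 hm, hQ.coeffA_recursion hc h1 hm]
        congr 1
        refine Finset.sum_congr rfl fun j hj => ?_
        rw [Finset.mem_Icc] at hj
        rw [ih (m - j) (by omega) (by omega)]
  funext n
  ext k
  rcases le_or_gt k (n * (n + 1) / 2) with hk | hk
  · have := hcoeff n (n * (n + 1) / 2 - k) (Nat.sub_le _ _)
    rwa [coeffA, coeffA, Nat.sub_sub_self hk] at this
  · rw [coeff_eq_zero_of_natDegree_lt (by rwa [hP.natDegree_eq hc]),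
      coeff_eq_zero_of_natDegree_lt (by rwa [hQ.natDegree_eq hc])]

end Coefficients

theorem mainTheorem8 :
    -- the polynomials are well defined
    (∃! Q : ℕ → ℂ[X], IsSpecialPolynomials Q) ∧
    -- the expansion at infinity is well defined, with coefficients only at exponents `-7l-1`
    (∀ α : ℂ, ∃! c : ℕ → ℂ, IsExpansionAtInfty α c) ∧
    (∀ (α : ℂ) (c : ℕ → ℂ), IsExpansionAtInfty α c → ∀ m : ℕ, ¬ 7 ∣ m → c m = 0) ∧
    -- the coefficients of the polynomials are obtained from those of the expansion
    (∀ (Q : ℕ → ℂ[X]) (c : ℂ → ℕ → ℂ), IsSpecialPolynomials Q →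
      (∀ α : ℂ, IsExpansionAtInfty α (c α)) →
      ∀ n : ℕ,
        ((Q n).natDegree = n * (n + 1) / 2 ∧
          ((Q n).natDegree : ℂ) = -∑ i ∈ Finset.Icc 1 n, c (i : ℂ) 0) ∧
        coeffA Q n 0 = 1 ∧
        (∀ m : ℕ, 1 ≤ m → m ≤ n * (n + 1) / 2 →
          coeffA Q n m =
            (∑ j ∈ Finset.Icc 1 m,
              (∑ i ∈ Finset.Icc 2 n, c (i : ℂ) j) * coeffA Q n (m - j)) / (m : ℂ)) ∧
        (∀ m : ℕ, m ≤ n * (n + 1) / 2 → ¬ 7 ∣ m → coeffA Q n m = 0)) := by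
  obtain ⟨Q, hQ⟩ := exists_isSpecialPolynomials
  refine ⟨⟨Q, hQ, fun P hP => hP.unique hQ⟩, existsUnique_isExpansionAtInfty,
    fun α c hc m hm => hc.eq_zero_of_not_dvd hm, fun Q c hQ hc n => ?_⟩
  exact ⟨⟨hQ.natDegree_eq hc n, hQ.natDegree_eq_neg_sum hc n⟩, hQ.coeffA_zero hc n,
    fun m h1 hm => hQ.coeffA_recursion hc h1 hm, fun m => hQ.coeffA_eq_zero_of_not_dvd hc m⟩
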